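/- A weighted graph $G$ has a finite nonempty node set $V(G)$, node weights $\alpha_u(G)>0$, and real edge weights $\beta_{uv}(G)=\beta_{vu}(G)$ (loops allowed; $\beta_{uv}=0$ for non-edges). Put $\alpha_G=\sum_u\alpha_u(G)$ and $\alpha_{\max}(G)=\max_u\alpha_u(G)$. Let $q\ge1$, and let $J\in\mathrm{Sym}_q$ be a real symmetric $q\times q$ matrix. For $\phi\colon V(G)\to[q]=\{1,\dots,q\}$ let $$\mathcal E_\phi(G,J)=-\sum_{u,v\in V(G)}\frac{\alpha_u(G)\alpha_v(G)}{\alpha_G^2}\,\beta_{uv}(G)\,J_{\phi(u)\phi(v)} .$$ For a probability distribution $\mathbf a=(a_1,\dots,a_q)$ on $[q]$ let $$\Omega_{\mathbf a}(G)=\Big\{\phi\colon V(G)\to[q]\ :\ \Big|\sum_{u\in\phi^{-1}(i)}\alpha_u(G)-a_i\alpha_G\Big|\le\alpha_{\max}(G)\ \text{ for all } i\in[q]\Big\},\qquad \hat{\mathcal E}_{\mathbf a}(G,J)=\min_{\phi\in\Omega_{\mathbf a}(G)}\mathcal E_\phi(G,J).$$ For $0\le c\le 1/q$ let $A_c$ be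 the set of probability distributions $\mathbf a$ on $[q]$ with $a_i\ge c$ for all $i$, and define the lower threshold ground state energy $\hat{\mathcal E}^{c}(G,J)=\inf_{\mathbf a\in A_c}\hat{\mathcal E}_{\mathbf a}(G,J)$. **Corollary 3.5.** Let $(G_n)_{n\ge1}$ be a sequence of weighted graphs with uniformly bounded edge weights (there is $B$ with $|\beta_{uv}(G_n)|\le B$ for all $n,u,v$) and $\alpha_{\max}(G_n)/\alpha_{G_n}\to0$ as $n\to\infty$. Let $0\le h_1<h_2\le1$, and let $c_1,c_2$ be functions of $q$ with $c_1(q)q=h_1$ and $c_2(q)q=h_2$ for all $q\ge1$. If for every $q\ge1$ and every $J\in\mathrm{Sym}_q$ the sequence $(\hat{\mathcal E}^{c_2(q)}(G_n,J))_{n\ge1}$ converges in $\mathbb R$, then for every $q\ge1$ and every $J\in\mathrm{Sym}_q$ the sequence $(\hat{\mathcal E}^{c_1(q)}(G_n,J))_{n\ge1}$ converges in $\mathbb R$. -/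

import Mathlib

open Filter Topology

/-- A weighted graph with finite node set `V`: node weights `α u > 0` and symmetric real edge
weights `β u v` (loops allowed). A pair that is not an edge has weight `0`; a simple graph is the
case `α = 1` and `β` the adjacency matrix. -/
structure WeightedGraph (V : Type*) where
  α : V → ℝ
  α_pos : ∀ u, 0 < α u
  β : V → V → ℝ
  β_symm : ∀ u v, β u v = β v u

namespace WeightedGraph

noncomputable section

variable {V : Type*} [Fintype V]

/-- The total node weight `α_G`. -/
def totalWeight (G : WeightedGraph V) : ℝ := ∑ u, G.α u

/-- The largest node weight `α_max(G)`. -/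
def maxWeight [Nonempty V] (G : WeightedGraph V) : ℝ :=
  Finset.univ.sup' Finset.univ_nonempty G.α

/-- The energy density of the spin configuration `φ` with respect to `J`; for a simple graph it is
`-(2 / |V|²) ∑_{uv ∈ E} J (φ u) (φ v)`. -/
def energy {q : ℕ} (G : WeightedGraph V) (J : Matrix (Fin q) (Fin q) ℝ) (φ : V → Fin q) : ℝ :=
  -∑ u, ∑ v, G.α u * G.α v / G.totalWeight ^ 2 * G.β u v * J (φ u) (φ v)

/-- `Ω_a(G)`: the spin configurations whose classes have relative weights `a`, up to the weight of
one node; for a simple graph the condition is `| |φ⁻¹(i)| - a i * |V| | ≤ 1`. -/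
def microConfigs [Nonempty V] {q : ℕ} (G : WeightedGraph V) (a : Fin q → ℝ) :
    Set (V → Fin q) :=
  {φ | ∀ i, |(∑ u with φ u = i, G.α u) - a i * G.totalWeight| ≤ G.maxWeight}

/-- The microcanonical ground state energy: the minimum of the energy over `Ω_a(G)` (a finite set,
nonempty for every probability distribution `a`). -/
def microEnergy [Nonempty V] {q : ℕ} (G : WeightedGraph V) (J : Matrix (Fin q) (Fin q) ℝ)
    (a : Fin q → ℝ) : ℝ :=
  sInf (G.energy J '' G.microConfigs a)

/-- `A_c`: the probability distributions on `q` states all of whose components are at least `c`. -/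
def thresholdSet (q : ℕ) (c : ℝ) : Set (Fin q → ℝ) :=
  {a | a ∈ stdSimplex ℝ (Fin q) ∧ ∀ i, c ≤ a i}

/-- The lower threshold ground state energy: the infimum of the microcanonical ground state
energies over `A_c`. -/
def lowerThresholdEnergy [Nonempty V] {q : ℕ} (G : WeightedGraph V) (c : ℝ)
    (J : Matrix (Fin q) (Fin q) ℝ) : ℝ :=
  sInf (G.microEnergy J '' thresholdSet q c)

end

end WeightedGraph

/-! A ground state problem on `q` states with total threshold `h₁` is approximated by finitely many
problems on `m` states with total threshold `h₂`. A map `π : Fin m → Fin q` merges states, and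
`J.submatrix π π` gives a configuration `φ` the energy that `J` gives `π ∘ φ`. Merging turns the
threshold `h₂ / m` into `fiberCard π i * (h₂ / m)`, so every `π` for which this is at least `h₁ / q`
bounds the `q`-state energy from above, up to a multiple of `α_max / α_G`
(`lowerThresholdEnergy_le_submatrix`). Conversely, as `h₁ < h₂`, every distribution admissible for
`h₁ / q` is within `O(1 / m)` of one compatible with such a `π` (`exists_partition_near`), and
splitting its classes evenly along the fibers gives the reverse bound
(`lowerThresholdEnergy_submatrix_le`). The minimum over these `π` converges in `n`, and its eventual
distance from the target is small for large `m`. Class weights are repaired throughout by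
`exists_rebalanced`, at a cost measured by `energy_sub_le`. -/

/-- The total weight of the class of `s` in the configuration `φ`. -/
def classWeight {V S : Type*} [Fintype V] [DecidableEq S] (α : V → ℝ) (φ : V → S) (s : S) : ℝ :=
  ∑ u with φ u = s, α u

/-! ### Rebalancing class weights by moving single nodes -/

section Rebalance

variable {V S I : Type*} [Fintype V] [DecidableEq S]

lemma classWeight_update [DecidableEq V] (α : V → ℝ) (φ : V → S) (u : V) (j s : S) :
    classWeight α (Function.update φ u j) s =
      classWeight α φ s + (if j = s then α u else 0) - (if φ u = s then α u else 0) := by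
  simp only [classWeight, Finset.sum_filter]
  rw [Fintype.sum_eq_add_sum_compl u, Fintype.sum_eq_add_sum_compl u (fun v => if φ v = s then _ else _)]
  have : ∑ v ∈ {u}ᶜ, (if Function.update φ u j v = s then α v else 0)
      = ∑ v ∈ {u}ᶜ, (if φ v = s then α v else 0) := by
    refine Finset.sum_congr rfl fun v hv => ?_
    rw [Function.update_of_ne (by simpa using hv)]
  rw [this, Function.update_self]
  ring

lemma sum_classWeight_fiber [Fintype S] [DecidableEq I] (α : V → ℝ) (π : S → I) (φ : V → S)
    (i : I) : ∑ s with π s = i, classWeight α φ s = classWeight α (π ∘ φ) i := by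
  simp only [classWeight]
  rw [← Finset.sum_fiberwise_of_maps_to (s := Finset.univ.filter fun u => (π ∘ φ) u = i)
    (t := Finset.univ.filter fun s => π s = i) (g := φ) (by simp)]
  refine Finset.sum_congr rfl fun s hs => ?_
  rw [Finset.filter_filter]
  refine Finset.sum_congr ?_ fun _ _ => rfl
  ext u
  simp only [Finset.mem_filter, Finset.mem_univ, true_and, Function.comp] at hs ⊢
  exact ⟨fun h => ⟨by rw [h, hs], h⟩, And.right⟩

lemma sum_classWeight [Fintype S] (α : V → ℝ) (φ : V → S) :
    ∑ s, classWeight α φ s = ∑ u, α u := by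
  simpa [classWeight] using sum_classWeight_fiber α (fun _ => ()) φ ()

lemma classWeight_nonneg {α : V → ℝ} (hα : ∀ u, 0 < α u) (φ : V → S) (s : S) :
    0 ≤ classWeight α φ s :=
  Finset.sum_nonneg fun u _ => (hα u).le

/-- `|t|` if this exceeds the tolerance `δ`, and `0` otherwise. -/
noncomputable def excess (δ t : ℝ) : ℝ := if |t| ≤ δ then 0 else |t|

lemma excess_nonneg (δ t : ℝ) : 0 ≤ excess δ t := by
  unfold excess; split_ifs <;> positivity

lemma excess_le_abs (δ t : ℝ) : excess δ t ≤ |t| := by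
  unfold excess; split_ifs <;> simp

/-- Since `a ≤ δ`, neither class can overshoot beyond the tolerance, so the class that was out of
tolerance gains at least `a` and the other loses nothing. For `|t|` in place of `excess` this fails:
a small deficit may become a larger surplus. -/
lemma excess_transfer {δ s t a : ℝ} (hs : 0 < s) (ht : t < 0) (ha : 0 < a) (haδ : a ≤ δ)
    (h : δ < s ∨ t < -δ) : excess δ (s - a) + excess δ (t + a) + a ≤ excess δ s + excess δ t := by
  unfold excess
  rw [abs_of_pos hs, abs_of_neg ht]
  rcases abs_cases (s - a) with ⟨h1, _⟩ | ⟨h1, _⟩ <;>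
  rcases abs_cases (t + a) with ⟨h2, _⟩ | ⟨h2, _⟩ <;>
  rw [h1, h2] <;> rcases h with h | h <;> split_ifs <;> linarith

/-- A configuration whose classes have the right total weight over each fiber of `π` can be moved,
within these fibers, to one whose classes have the prescribed weights up to the weight of one node;
the weight of the nodes that change class is controlled by the initial discrepancy. -/
lemma exists_rebalanced [Fintype S] [DecidableEq I] {α : V → ℝ} (hα : ∀ u, 0 < α u) {δ : ℝ}
    (hδ₀ : 0 ≤ δ) (hδ : ∀ u, α u ≤ δ) (π : S → I) {T : S → ℝ} (hT : ∀ s, 0 ≤ T s) (φ₀ : V → S)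
    (hbal : ∀ i, classWeight α (π ∘ φ₀) i = ∑ s with π s = i, T s) :
    ∃ φ : V → S, π ∘ φ = π ∘ φ₀ ∧ (∀ s, |classWeight α φ s - T s| ≤ δ) ∧
      ∑ u with φ u ≠ φ₀ u, α u ≤ 2 * ∑ s, |classWeight α φ₀ s - T s| := by
  classical
  -- The factor 2 makes a useful move strictly profitable: it saves at least `2 * α u` of excess and
  -- adds at most `α u` of moved weight. Comparing the minimizer with `φ₀` then bounds the moved
  -- weight.
  let H : (V → S) → ℝ := fun φ =>
    2 * ∑ s, excess δ (classWeight α φ s - T s) + ∑ u with φ u ≠ φ₀ u, α u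
  obtain ⟨φ, hφ, hmin⟩ := Finset.exists_min_image
    (Finset.univ.filter fun φ : V → S => π ∘ φ = π ∘ φ₀) H ⟨φ₀, by simp⟩
  simp only [Finset.mem_filter, Finset.mem_univ, true_and] at hφ hmin
  have hnn : 0 ≤ ∑ s, excess δ (classWeight α φ s - T s) :=
    Finset.sum_nonneg fun s _ => excess_nonneg _ _
  refine ⟨φ, hφ, ?_, ?_⟩
  · by_contra! hbad
    obtain ⟨s₀, hs₀⟩ := hbad
    have hzero : ∀ i, ∑ s with π s = i, (classWeight α φ s - T s) = 0 := by
      intro i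
      rw [Finset.sum_sub_distrib, sum_classWeight_fiber, hφ, hbal, sub_self]
    -- Discrepancies cancel over each fiber, so a class out of tolerance has a partner of opposite
    -- sign in its fiber.
    have key : ∃ i j, π i = π j ∧ 0 < classWeight α φ i - T i ∧ classWeight α φ j - T j < 0 ∧
        (δ < classWeight α φ i - T i ∨ classWeight α φ j - T j < -δ) := by
      rcases lt_abs.1 hs₀ with h | h
      · obtain ⟨j, hj, hj'⟩ : ∃ j ∈ Finset.univ.filter fun s => π s = π s₀,
            classWeight α φ j - T j < 0 := by
          by_contra! hc
          have := Finset.sum_pos' hc ⟨s₀, by simp, hδ₀.trans_lt h⟩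
          rw [hzero] at this
          exact this.false
        exact ⟨s₀, j, (by simpa using hj : π j = π s₀).symm, hδ₀.trans_lt h, hj', Or.inl h⟩
      · obtain ⟨j, hj, hj'⟩ : ∃ j ∈ Finset.univ.filter fun s => π s = π s₀,
            0 < classWeight α φ j - T j := by
          by_contra! hc
          have := Finset.sum_neg' hc ⟨s₀, by simp, by linarith⟩
          rw [hzero] at this
          exact this.false
        exact ⟨j, s₀, by simpa using hj, hj', by linarith, Or.inr (by linarith)⟩
    obtain ⟨i, j, hij, hi, hj, hor⟩ := key
    have hij' : i ≠ j := by rintro rfl; linarith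
    obtain ⟨u, hu⟩ : ∃ u, φ u = i := by
      by_contra! hc
      have : classWeight α φ i = 0 := by simp [classWeight, hc]
      linarith [hT i]
    have hle := hmin (Function.update φ u j) (by
      rw [← hφ]; ext v
      by_cases hv : v = u
      · subst hv; simp [hu, hij]
      · simp [hv])
    have h1 : ∑ s, excess δ (classWeight α (Function.update φ u j) s - T s) + α u
        ≤ ∑ s, excess δ (classWeight α φ s - T s) := by
      have hsplit : ∀ f : S → ℝ, ∑ s, f s = f i + f j + ∑ s ∈ {i, j}ᶜ, f s := by
        intro f
        rw [← Finset.sum_add_sum_compl {i, j}, Finset.sum_pair hij']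
      rw [hsplit, hsplit (fun s => excess δ (classWeight α φ s - T s))]
      have hrest : ∑ s ∈ {i, j}ᶜ, excess δ (classWeight α (Function.update φ u j) s - T s)
          = ∑ s ∈ {i, j}ᶜ, excess δ (classWeight α φ s - T s) := by
        refine Finset.sum_congr rfl fun s hs => ?_
        simp only [Finset.mem_compl, Finset.mem_insert, Finset.mem_singleton, not_or] at hs
        rw [classWeight_update, if_neg (Ne.symm hs.2), if_neg (by rw [hu]; exact Ne.symm hs.1)]
        simp
      have := excess_transfer hi hj (hα u) (hδ u) hor
      rw [hrest, classWeight_update, classWeight_update, hu, if_neg hij'.symm, if_pos rfl,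
        if_pos rfl, if_neg hij']
      have e1 : classWeight α φ i + 0 - α u - T i = classWeight α φ i - T i - α u := by ring
      have e2 : classWeight α φ j + α u - 0 - T j = classWeight α φ j - T j + α u := by ring
      rw [e1, e2]
      linarith
    have h2 : ∑ v with Function.update φ u j v ≠ φ₀ v, α v
        ≤ ∑ v with φ v ≠ φ₀ v, α v + α u := by
      rw [Finset.sum_filter, Finset.sum_filter]
      have : α u = ∑ v, if v = u then α v else 0 := by simp
      rw [this, ← Finset.sum_add_distrib]
      refine Finset.sum_le_sum fun v _ => ?_
      have := hα v
      by_cases hv : v = u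
      · subst hv
        simp only [if_true]
        split_ifs <;> linarith
      · simp [hv]
    simp only [H] at hle
    linarith [hα u]
  · have h0 := hmin φ₀ rfl
    have h1 : H φ₀ = 2 * ∑ s, excess δ (classWeight α φ₀ s - T s) := by simp [H]
    have h2 : ∑ s, excess δ (classWeight α φ₀ s - T s) ≤ ∑ s, |classWeight α φ₀ s - T s| :=
      Finset.sum_le_sum fun s _ => excess_le_abs _ _
    rw [h1] at h0
    simp only [H] at h0
    linarith

end Rebalance

/-! ### Stability of the energy and attainment of the infima -/

namespace WeightedGraph

variable {V : Type*} [Fintype V] {q : ℕ}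

/-- Only pairs with a moved endpoint contribute. One factor 2 comes from the two possible endpoints,
the other from the difference of two entries of `J`. -/
lemma energy_sub_le (G : WeightedGraph V) (hG : 0 < G.totalWeight) {B M : ℝ}
    (hB₀ : 0 ≤ B) (hM₀ : 0 ≤ M)
    (hB : ∀ u v, |G.β u v| ≤ B) {J : Matrix (Fin q) (Fin q) ℝ} (hM : ∀ i j, |J i j| ≤ M)
    (φ ψ : V → Fin q) :
    G.energy J φ - G.energy J ψ ≤ 4 * (B * M) * ((∑ u with φ u ≠ ψ u, G.α u) / G.totalWeight) := by
  set D := ∑ u with φ u ≠ ψ u, G.α u with hD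
  let d : V → ℝ := fun u => if φ u ≠ ψ u then G.α u else 0
  have hd : ∑ u, d u = D := by rw [hD, Finset.sum_filter]
  have hterm : ∀ u v, G.α u * G.α v / G.totalWeight ^ 2 * G.β u v * J (ψ u) (ψ v)
      - G.α u * G.α v / G.totalWeight ^ 2 * G.β u v * J (φ u) (φ v)
      ≤ 2 * (B * M) / G.totalWeight ^ 2 * (d u * G.α v + G.α u * d v) := by
    intro u v
    have hu := G.α_pos u
    have hv := G.α_pos v
    have hdu : 0 ≤ d u := by simp only [d]; split_ifs <;> linarith
    have hdv : 0 ≤ d v := by simp only [d]; split_ifs <;> linarith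
    by_cases h : φ u = ψ u ∧ φ v = ψ v
    · rw [h.1, h.2, sub_self]
      positivity
    · have h1 : G.α u * G.α v ≤ d u * G.α v + G.α u * d v := by
        rw [not_and_or] at h
        rcases h with h | h
        · have : d u = G.α u := by simp [d, h]
          rw [this]
          have : 0 ≤ G.α u * d v := by positivity
          linarith
        · have : d v = G.α v := by simp [d, h]
          rw [this]
          have : 0 ≤ d u * G.α v := by positivity
          linarith
      have h2 : G.β u v * (J (ψ u) (ψ v) - J (φ u) (φ v)) ≤ 2 * (B * M) := by
        refine (le_abs_self _).trans ?_
        rw [abs_mul]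
        have : |J (ψ u) (ψ v) - J (φ u) (φ v)| ≤ 2 * M :=
          (abs_sub _ _).trans (by linarith [hM (ψ u) (ψ v), hM (φ u) (φ v)])
        calc _ ≤ B * (2 * M) := mul_le_mul (hB u v) this (abs_nonneg _) hB₀
          _ = _ := by ring
      calc _ = G.α u * G.α v / G.totalWeight ^ 2 *
              (G.β u v * (J (ψ u) (ψ v) - J (φ u) (φ v))) := by ring
        _ ≤ G.α u * G.α v / G.totalWeight ^ 2 * (2 * (B * M)) := by gcongr
        _ = 2 * (B * M) / G.totalWeight ^ 2 * (G.α u * G.α v) := by ring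
        _ ≤ _ := by gcongr
  calc G.energy J φ - G.energy J ψ
      = ∑ u, ∑ v, (G.α u * G.α v / G.totalWeight ^ 2 * G.β u v * J (ψ u) (ψ v)
      - G.α u * G.α v / G.totalWeight ^ 2 * G.β u v * J (φ u) (φ v)) := by
        simp only [energy, Finset.sum_sub_distrib]; ring
    _ ≤ ∑ u, ∑ v, 2 * (B * M) / G.totalWeight ^ 2 * (d u * G.α v + G.α u * d v) :=
        Finset.sum_le_sum fun u _ => Finset.sum_le_sum fun v _ => hterm u v
    _ = 2 * (B * M) / G.totalWeight ^ 2 * (D * G.totalWeight + G.totalWeight * D) := by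
        simp only [← Finset.mul_sum, Finset.sum_add_distrib, ← Finset.sum_mul, hd]
        rfl
    _ = _ := by field_simp; ring

variable [Nonempty V]

lemma totalWeight_pos (G : WeightedGraph V) : 0 < G.totalWeight :=
  Finset.sum_pos (fun u _ => G.α_pos u) Finset.univ_nonempty

lemma le_maxWeight (G : WeightedGraph V) (u : V) : G.α u ≤ G.maxWeight :=
  Finset.le_sup' G.α (Finset.mem_univ u)

lemma maxWeight_nonneg (G : WeightedGraph V) : 0 ≤ G.maxWeight :=
  (G.α_pos (Classical.arbitrary V)).le.trans (G.le_maxWeight _)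

lemma mem_microConfigs (G : WeightedGraph V) {a : Fin q → ℝ} {φ : V → Fin q} :
    φ ∈ G.microConfigs a ↔
      ∀ i, |classWeight G.α φ i - a i * G.totalWeight| ≤ G.maxWeight := Iff.rfl

/-- Every configuration is close to one with prescribed class weights. -/
lemma exists_mem_microConfigs (G : WeightedGraph V) {a : Fin q → ℝ}
    (ha : a ∈ stdSimplex ℝ (Fin q)) (φ₀ : V → Fin q) :
    ∃ φ ∈ G.microConfigs a, ∑ u with φ u ≠ φ₀ u, G.α u ≤
      2 * ∑ i, |classWeight G.α φ₀ i - a i * G.totalWeight| := by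
  obtain ⟨φ, -, h1, h2⟩ := exists_rebalanced G.α_pos G.maxWeight_nonneg G.le_maxWeight
    (fun _ : Fin q => ()) (T := fun i => a i * G.totalWeight)
    (fun i => mul_nonneg (ha.1 i) G.totalWeight_pos.le) φ₀ (by
      intro i
      simp [classWeight, ← Finset.sum_mul, ha.2, totalWeight])
  exact ⟨φ, h1, h2⟩

/-- Each value is `sInf` of a subset of the finite range of the energy. Hence the infimum over the
infinite set `A` is attained. -/
lemma finite_image_microEnergy (G : WeightedGraph V) (J : Matrix (Fin q) (Fin q) ℝ)
    (A : Set (Fin q → ℝ)) : (G.microEnergy J '' A).Finite := by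
  refine ((Set.finite_range (G.energy J)).finite_subsets.image sInf).subset ?_
  rintro _ ⟨b, -, rfl⟩
  exact ⟨_, Set.image_subset_range _ _, rfl⟩

lemma lowerThresholdEnergy_le (G : WeightedGraph V) (J : Matrix (Fin q) (Fin q) ℝ) {c : ℝ}
    {a : Fin q → ℝ} (ha : a ∈ thresholdSet q c) {φ : V → Fin q} (hφ : φ ∈ G.microConfigs a) :
    G.lowerThresholdEnergy c J ≤ G.energy J φ := by
  exact (csInf_le (G.finite_image_microEnergy J _).bddBelow ⟨a, ha, rfl⟩).trans
    (csInf_le ((Set.toFinite _).image _).bddBelow ⟨φ, hφ, rfl⟩)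

lemma exists_energy_eq_lowerThresholdEnergy (G : WeightedGraph V)
    (J : Matrix (Fin q) (Fin q) ℝ) {c : ℝ} (hc : (thresholdSet q c).Nonempty) (hq : 0 < q) :
    ∃ a ∈ thresholdSet q c, ∃ φ ∈ G.microConfigs a,
      G.energy J φ = G.lowerThresholdEnergy c J := by
  obtain ⟨a, ha, haE⟩ := (hc.image (G.microEnergy J)).csInf_mem
    (G.finite_image_microEnergy J _)
  obtain ⟨ψ, hψ, -⟩ := G.exists_mem_microConfigs ha.1 (fun _ => ⟨0, hq⟩)
  obtain ⟨φ, hφ, hφE⟩ := (Set.Nonempty.image (G.energy J) ⟨ψ, hψ⟩).csInf_mem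
    ((Set.toFinite (G.microConfigs a)).image _)
  exact ⟨a, ha, φ, hφ, hφE.trans haE⟩

end WeightedGraph

/-! ### Partitions of `m` states into `q` classes -/

/-- The number of preimages of `i`, as a real number. -/
noncomputable def fiberCard {m q : ℕ} (π : Fin m → Fin q) (i : Fin q) : ℝ :=
  ((Finset.univ.filter fun s => π s = i).card : ℝ)

lemma sum_comp_eq_sum_fiberCard_mul {m q : ℕ} (π : Fin m → Fin q) (f : Fin q → ℝ) :
    ∑ s, f (π s) = ∑ i, fiberCard π i * f i := by
  rw [← Finset.sum_fiberwise' Finset.univ π f]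
  simp [fiberCard]

lemma sum_fiberCard {m q : ℕ} (π : Fin m → Fin q) : ∑ i, fiberCard π i = m := by
  simpa using (sum_comp_eq_sum_fiberCard_mul π fun _ => 1).symm

lemma exists_fiberCard_near {q : ℕ} (m : ℕ) {z : Fin q → ℝ} (hz : z ∈ stdSimplex ℝ (Fin q)) :
    ∃ π : Fin m → Fin q, ∀ i, |fiberCard π i - m * z i| ≤ 1 := by
  have hq : 0 < q := by
    rcases Nat.eq_zero_or_pos q with rfl | h
    · have := hz.2
      simp at this
    · exact h
  obtain ⟨π, -, hπ, -⟩ := exists_rebalanced (V := Fin m) (α := fun _ => 1) (fun _ => one_pos)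
    zero_le_one (fun _ => le_rfl) (fun _ : Fin q => ()) (T := fun i => m * z i)
    (fun i => mul_nonneg m.cast_nonneg (hz.1 i)) (fun _ => ⟨0, hq⟩) (by
      intro i
      simp [classWeight, ← Finset.mul_sum, hz.2])
  exact ⟨π, by simpa [classWeight, fiberCard] using hπ⟩

/-- A distribution bounded below by `h₁ / q` dominates one built from a partition of `m` states
whose classes carry the total threshold `h₂`, up to an error of order `1 / m`. -/
lemma exists_partition_near {q m : ℕ} {h₁ h₂ : ℝ} (hq : 1 ≤ q) (h₁_nonneg : 0 ≤ h₁)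
    (h₁_lt_h₂ : h₁ < h₂) (h₂_le_one : h₂ ≤ 1) (hm : 1 ≤ m)
    (hmK : 2 * h₂ * q / (h₂ - h₁) ≤ m) {a : Fin q → ℝ}
    (ha : a ∈ WeightedGraph.thresholdSet q (h₁ / q)) :
    ∃ π : Fin m → Fin q, ∃ b ∈ stdSimplex ℝ (Fin q), (∀ i, 1 ≤ fiberCard π i) ∧
      (∀ i, h₁ / q ≤ fiberCard π i * (h₂ / m)) ∧ (∀ i, fiberCard π i * (h₂ / m) ≤ b i) ∧
      ∀ i, |a i - b i| ≤ (1 + 2 * h₂ * q / (h₂ - h₁)) / m := by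
  set K := 2 * h₂ * q / (h₂ - h₁) with hK
  have hq' : (1 : ℝ) ≤ q := by exact_mod_cast hq
  have hm' : (1 : ℝ) ≤ m := by exact_mod_cast hm
  have hq0 : (0 : ℝ) < q := by linarith
  have hm0 : (0 : ℝ) < m := by linarith
  have hh₂ : 0 < h₂ := by linarith
  have hd : 0 < h₂ - h₁ := by linarith
  have h1 : 0 < 1 - h₁ := by linarith
  have hK0 : 0 ≤ K := by positivity
  let t : ℝ := K / m
  have ht0 : 0 ≤ t := by positivity
  have ht1 : t ≤ 1 := by simp only [t]; rw [div_le_one hm0]; exact hmK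
  have htm : t * m = K := by simp only [t]; field_simp
  let p : Fin q → ℝ := fun i => (a i - h₁ / q) / (1 - h₁)
  have hp0 : ∀ i, 0 ≤ p i := fun i => div_nonneg (by linarith [ha.2 i]) h1.le
  have hp1 : ∑ i, p i = 1 := by
    simp only [p, ← Finset.sum_div, Finset.sum_sub_distrib, ha.1.2]
    simp only [Finset.sum_const, Finset.card_univ, Fintype.card_fin, nsmul_eq_mul]
    rw [mul_div_cancel_left₀ _ hq0.ne', div_self h1.ne']
  have hap : ∀ i, a i = h₁ / q + (1 - h₁) * p i := fun i => by simp only [p]; field_simp; ring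
  -- `h₂ * y` is a part of `a` of total mass `h₂` that still respects the threshold `h₁ / q`; `π` is
  -- to have fiber proportions close to `y`.
  let y : Fin q → ℝ := fun i => (h₁ / q + (h₂ - h₁) * p i) / h₂
  have hy0 : ∀ i, 0 ≤ y i := fun i => by
    have := hp0 i
    positivity
  have hy1 : ∑ i, y i = 1 := by
    simp only [y, ← Finset.sum_div, Finset.sum_add_distrib, ← Finset.mul_sum, hp1]
    simp only [Finset.sum_const, Finset.card_univ, Fintype.card_fin, nsmul_eq_mul]
    rw [mul_div_cancel_left₀ _ hq0.ne']
    field_simp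
    ring
  have hyl : ∀ i, h₁ / q / h₂ ≤ y i := fun i => by
    have := hp0 i
    simp only [y]
    gcongr
    nlinarith
  have hya : ∀ i, h₂ * y i ≤ a i := fun i => by
    have := hp0 i
    have e : h₂ * y i = h₁ / q + (h₂ - h₁) * p i := by simp only [y]; field_simp
    rw [e, hap]
    gcongr
  have hy_le : ∀ i, y i ≤ 1 := fun i => by
    rw [← hy1]
    exact Finset.single_le_sum (fun j _ => hy0 j) (Finset.mem_univ i)
  -- Mixing in weight `t` of the uniform distribution raises the lower bound for `m * z i` by
  -- exactly 2: one unit pays for rounding, the other keeps every fiber nonempty.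
  let z : Fin q → ℝ := fun i => (1 - t) * y i + t / q
  have hz : z ∈ stdSimplex ℝ (Fin q) := by
    refine ⟨fun i => add_nonneg (mul_nonneg (by linarith) (hy0 i)) (by positivity), ?_⟩
    simp only [z, Finset.sum_add_distrib, ← Finset.mul_sum, hy1]
    simp only [Finset.sum_const, Finset.card_univ, Fintype.card_fin, nsmul_eq_mul]
    rw [mul_div_cancel₀ _ hq0.ne']
    ring
  obtain ⟨π, hπ⟩ := exists_fiberCard_near m hz
  have hlow : ∀ i, m * (h₁ / q / h₂) + 1 ≤ fiberCard π i := by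
    intro i
    have h2 : (1 - t) * (h₁ / q / h₂) + t / q ≤ z i := by
      simp only [z]
      have : 0 ≤ 1 - t := by linarith
      gcongr
      exact hyl i
    have h3 : m * ((1 - t) * (h₁ / q / h₂) + t / q) = m * (h₁ / q / h₂) + 2 := by
      have : m * ((1 - t) * (h₁ / q / h₂) + t / q)
          = m * (h₁ / q / h₂) + (t * m) * (1 / q - h₁ / q / h₂) := by ring
      rw [this, htm, hK]
      field_simp
    have h4 : m * ((1 - t) * (h₁ / q / h₂) + t / q) ≤ m * z i := by gcongr
    linarith [(abs_le.1 (hπ i)).1]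
  have hpos : ∀ i, (0 : ℝ) ≤ fiberCard π i := fun i => Nat.cast_nonneg _
  -- In `a`, the part `h₂ * y` is replaced by its rounded version; the remainder `a - h₂ * y` is
  -- nonnegative.
  refine ⟨π, fun i => fiberCard π i * (h₂ / m) + (a i - h₂ * y i), ⟨fun i => ?_, ?_⟩, fun i => ?_,
    fun i => ?_, fun i => ?_, fun i => ?_⟩
  · have := hya i
    have := hpos i
    have : 0 ≤ fiberCard π i * (h₂ / m) := by positivity
    linarith
  · rw [Finset.sum_add_distrib, ← Finset.sum_mul, sum_fiberCard, Finset.sum_sub_distrib,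
      ← Finset.mul_sum, hy1, ha.1.2]
    field_simp
    ring
  · have := hlow i
    have : 0 ≤ m * (h₁ / q / h₂) := by positivity
    linarith
  · have h5 : (m * (h₁ / q / h₂)) * (h₂ / m) ≤ fiberCard π i * (h₂ / m) := by
      gcongr
      linarith [hlow i]
    have h6 : (m * (h₁ / q / h₂)) * (h₂ / m) = h₁ / q := by field_simp
    linarith
  · linarith [hya i]
  · have e : a i - (fiberCard π i * (h₂ / m) + (a i - h₂ * y i))
        = h₂ * (-((fiberCard π i - m * z i) / m) + t * (y i - 1 / q)) := by
      simp only [z]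
      field_simp
      ring
    have hinv : 1 / (q : ℝ) ≤ 1 := by rw [div_le_one hq0]; exact hq'
    have hinv0 : 0 ≤ 1 / (q : ℝ) := by positivity
    have hA : |(fiberCard π i - m * z i) / m| ≤ 1 / m := by
      rw [abs_div, abs_of_pos hm0]
      gcongr
      exact hπ i
    have hB : |t * (y i - 1 / q)| ≤ t := by
      rw [abs_mul, abs_of_nonneg ht0]
      refine mul_le_of_le_one_right ht0 (abs_le.2 ⟨?_, ?_⟩) <;> linarith [hy0 i, hy_le i]
    rw [e, abs_mul, abs_of_pos hh₂, add_div]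
    refine (mul_le_of_le_one_left (abs_nonneg _) h₂_le_one).trans ((abs_add_le _ _).trans ?_)
    rw [abs_neg]
    exact add_le_add hA hB

/-! ### Merging and splitting states -/

namespace WeightedGraph

variable {V : Type*} [Fintype V] [Nonempty V] {q m : ℕ}

lemma lowerThresholdEnergy_le_submatrix (G : WeightedGraph V) {B M : ℝ} (hB₀ : 0 ≤ B)
    (hM₀ : 0 ≤ M) (hB : ∀ u v, |G.β u v| ≤ B) {J : Matrix (Fin q) (Fin q) ℝ}
    (hM : ∀ i j, |J i j| ≤ M) (π : Fin m → Fin q) (hm : 0 < m) {c c' : ℝ}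
    (hc : ∀ i, c ≤ fiberCard π i * c') (hc' : (thresholdSet m c').Nonempty) :
    G.lowerThresholdEnergy c J ≤ G.lowerThresholdEnergy c' (J.submatrix π π) +
      4 * (B * M) * (2 * m * (G.maxWeight / G.totalWeight)) := by
  obtain ⟨a, ha, φ, hφ, hE⟩ := G.exists_energy_eq_lowerThresholdEnergy (J.submatrix π π) hc' hm
  let b : Fin q → ℝ := fun i => ∑ s with π s = i, a s
  have hb : b ∈ thresholdSet q c := by
    refine ⟨⟨fun i => Finset.sum_nonneg fun s _ => ha.1.1 s, ?_⟩, fun i => (hc i).trans ?_⟩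
    · rw [← ha.1.2]
      exact Finset.sum_fiberwise _ _ _
    · rw [fiberCard, ← nsmul_eq_mul]
      exact Finset.card_nsmul_le_sum _ _ _ fun s _ => ha.2 s
  obtain ⟨ψ, hψ, hD⟩ := G.exists_mem_microConfigs hb.1 (π ∘ φ)
  have hdev : ∑ i, |classWeight G.α (π ∘ φ) i - b i * G.totalWeight| ≤ m * G.maxWeight := by
    have h1 : ∀ i, |classWeight G.α (π ∘ φ) i - b i * G.totalWeight|
        ≤ fiberCard π i * G.maxWeight := by
      intro i
      rw [← sum_classWeight_fiber, Finset.sum_mul, ← Finset.sum_sub_distrib, fiberCard,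
        ← nsmul_eq_mul]
      exact (Finset.abs_sum_le_sum_abs _ _).trans
        (Finset.sum_le_card_nsmul _ _ _ fun s _ => hφ s)
    refine (Finset.sum_le_sum fun i _ => h1 i).trans ?_
    rw [← Finset.sum_mul, sum_fiberCard]
  have hpos := G.totalWeight_pos
  have h2 := G.energy_sub_le hpos hB₀ hM₀ hB hM ψ (π ∘ φ)
  have h3 : G.energy J (π ∘ φ) = G.energy (J.submatrix π π) φ := rfl
  have h4 : (∑ u with ψ u ≠ (π ∘ φ) u, G.α u) / G.totalWeight
      ≤ 2 * m * (G.maxWeight / G.totalWeight) := by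
    rw [← mul_div_assoc]
    gcongr
    linarith
  have h5 := mul_le_mul_of_nonneg_left h4 (by positivity : 0 ≤ 4 * (B * M))
  linarith [G.lowerThresholdEnergy_le J hb hψ]

lemma lowerThresholdEnergy_submatrix_le (G : WeightedGraph V) {B M : ℝ} (hB₀ : 0 ≤ B)
    (hM₀ : 0 ≤ M) (hB : ∀ u v, |G.β u v| ≤ B) {J : Matrix (Fin q) (Fin q) ℝ}
    (hM : ∀ i j, |J i j| ≤ M) (π : Fin m → Fin q) (hπ : ∀ i, 1 ≤ fiberCard π i) {c' : ℝ}
    {a b : Fin q → ℝ} (hb : b ∈ stdSimplex ℝ (Fin q)) (hcb : ∀ i, fiberCard π i * c' ≤ b i)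
    {φ : V → Fin q} (hφ : φ ∈ G.microConfigs a) :
    G.lowerThresholdEnergy c' (J.submatrix π π) ≤ G.energy J φ + 4 * (B * M) *
      (2 * ((m + q) * (G.maxWeight / G.totalWeight) + ∑ i, |a i - b i|)) := by
  have hk : ∀ i, 0 < fiberCard π i := fun i => one_pos.trans_le (hπ i)
  have hpos := G.totalWeight_pos
  have hsurj : ∀ i, ∃ s, π s = i := by
    intro i
    have := hk i
    rw [fiberCard, Nat.cast_pos, Finset.card_pos] at this
    obtain ⟨s, hs⟩ := this
    exact ⟨s, by simpa using hs⟩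
  choose σ hσ using hsurj
  -- Any lift of `φ` through `π` will do: rebalancing within fibers spreads each class evenly
  -- without changing the energy.
  have hcomp : π ∘ (σ ∘ φ) = φ := funext fun u => hσ (φ u)
  obtain ⟨φ₁, hφ₁, hW, -⟩ := exists_rebalanced G.α_pos G.maxWeight_nonneg G.le_maxWeight π
    (T := fun s => classWeight G.α φ (π s) / fiberCard π (π s))
    (fun s => div_nonneg (classWeight_nonneg G.α_pos _ _) (hk _).le) (σ ∘ φ) (by
      intro i
      rw [hcomp, Finset.sum_congr rfl (g := fun _ => classWeight G.α φ i / fiberCard π i)]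
      · rw [Finset.sum_const, nsmul_eq_mul]
        exact (mul_div_cancel₀ _ (hk i).ne').symm
      · intro s hs
        rw [(by simpa using hs : π s = i)])
  rw [hcomp] at hφ₁
  let a' : Fin m → ℝ := fun s => b (π s) / fiberCard π (π s)
  have hsum : ∀ f : Fin q → ℝ, ∑ s, f (π s) / fiberCard π (π s) = ∑ i, f i := by
    intro f
    rw [sum_comp_eq_sum_fiberCard_mul π fun i => f i / fiberCard π i]
    exact Finset.sum_congr rfl fun i _ => mul_div_cancel₀ _ (hk i).ne'
  have ha' : a' ∈ thresholdSet m c' := by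
    refine ⟨⟨fun s => div_nonneg (hb.1 _) (hk _).le, (hsum b).trans hb.2⟩, fun s => ?_⟩
    rw [le_div_iff₀ (hk _), mul_comm]
    exact hcb _
  -- A second rebalancing, now across fibers, passes from the even split of the classes of `φ` to
  -- that of `b`; only this one costs energy.
  obtain ⟨ψ, hψ, hD⟩ := G.exists_mem_microConfigs ha'.1 φ₁
  have hdev : ∑ s, |classWeight G.α φ₁ s - a' s * G.totalWeight| ≤
      (m + q) * G.maxWeight + (∑ i, |a i - b i|) * G.totalWeight := by
    have h1 : ∀ s, |classWeight G.α φ₁ s - a' s * G.totalWeight| ≤ G.maxWeight +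
        (G.maxWeight + |a (π s) - b (π s)| * G.totalWeight) / fiberCard π (π s) := by
      intro s
      refine (abs_sub_le _ (classWeight G.α φ (π s) / fiberCard π (π s)) _).trans
        (add_le_add (hW s) ?_)
      simp only [a']
      rw [div_mul_eq_mul_div, ← sub_div, abs_div, abs_of_pos (hk _)]
      refine div_le_div_of_nonneg_right ?_ (hk _).le
      refine (abs_sub_le _ (a (π s) * G.totalWeight) _).trans (add_le_add (hφ _) ?_)
      rw [← sub_mul, abs_mul, abs_of_pos hpos]
    refine (Finset.sum_le_sum fun s _ => h1 s).trans ?_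
    rw [Finset.sum_add_distrib, hsum fun i => G.maxWeight + |a i - b i| * G.totalWeight,
      Finset.sum_add_distrib, ← Finset.sum_mul]
    simp only [Finset.sum_const, Finset.card_univ, Fintype.card_fin, nsmul_eq_mul]
    linarith
  have h2 := G.energy_sub_le hpos hB₀ hM₀ hB (J := J.submatrix π π)
    (fun i j => hM (π i) (π j)) ψ φ₁
  have h3 : G.energy (J.submatrix π π) φ₁ = G.energy J φ := by
    rw [← hφ₁]; rfl
  have h4 : (∑ u with ψ u ≠ φ₁ u, G.α u) / G.totalWeight
      ≤ 2 * ((m + q) * (G.maxWeight / G.totalWeight) + ∑ i, |a i - b i|) := by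
    rw [div_le_iff₀ hpos]
    have : 2 * ((m + q) * (G.maxWeight / G.totalWeight) + ∑ i, |a i - b i|) * G.totalWeight
        = 2 * ((m + q) * G.maxWeight + (∑ i, |a i - b i|) * G.totalWeight) := by
      field_simp
    rw [this]
    linarith
  have h5 := mul_le_mul_of_nonneg_left h4 (by positivity : 0 ≤ 4 * (B * M))
  linarith [G.lowerThresholdEnergy_le (J.submatrix π π) ha' hψ]

end WeightedGraph

/-! ### Passage to the limit -/

lemma exists_tendsto_of_approx {u : ℕ → ℝ}
    (h : ∀ ε > 0, ∃ (v : ℕ → ℝ) (l : ℝ), Tendsto v atTop (𝓝 l) ∧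
      ∀ᶠ n in atTop, |u n - v n| ≤ ε) : ∃ l, Tendsto u atTop (𝓝 l) := by
  refine cauchySeq_tendsto_of_complete (Metric.cauchySeq_iff'.2 fun ε hε => ?_)
  obtain ⟨v, l, hv, huv⟩ := h (ε / 5) (by positivity)
  have hv' := hv.eventually (Metric.ball_mem_nhds l (by positivity : 0 < ε / 5))
  obtain ⟨N, hN⟩ := eventually_atTop.1 (huv.and hv')
  refine ⟨N, fun n hn => ?_⟩
  have h1 := hN n hn
  have h2 := hN N le_rfl
  simp only [Real.dist_eq] at h1 h2 ⊢
  rw [abs_le, abs_lt] at h1 h2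
  rw [abs_lt]
  constructor <;> linarith [h1.1.1, h1.1.2, h1.2.1, h1.2.2, h2.1.1, h2.1.2, h2.2.1, h2.2.2]

theorem corollary3p5 {V : ℕ → Type*} [∀ n, Fintype (V n)] [∀ n, Nonempty (V n)]
    (G : ∀ n, WeightedGraph (V n))
    (hβ : ∃ B : ℝ, ∀ n u v, |(G n).β u v| ≤ B)
    (hα : Tendsto (fun n => (G n).maxWeight / (G n).totalWeight) atTop (𝓝 0))
    (c₁ c₂ : ℕ → ℝ) (h₁ h₂ : ℝ) (h₁_nonneg : 0 ≤ h₁) (h₁_lt_h₂ : h₁ < h₂) (h₂_le_one : h₂ ≤ 1)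
    (hc₁ : ∀ q : ℕ, 1 ≤ q → c₁ q * q = h₁)
    (hc₂ : ∀ q : ℕ, 1 ≤ q → c₂ q * q = h₂)
    (hconv : ∀ q : ℕ, 1 ≤ q → ∀ J : Matrix (Fin q) (Fin q) ℝ, J.IsSymm →
      ∃ l : ℝ, Tendsto (fun n => (G n).lowerThresholdEnergy (c₂ q) J) atTop (𝓝 l)) :
    ∀ q : ℕ, 1 ≤ q → ∀ J : Matrix (Fin q) (Fin q) ℝ, J.IsSymm →
      ∃ l : ℝ, Tendsto (fun n => (G n).lowerThresholdEnergy (c₁ q) J) atTop (𝓝 l) := by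
  classical
  intro q hq J hJ
  obtain ⟨B, hB⟩ := hβ
  have hB₀ : 0 ≤ B :=
    (abs_nonneg _).trans (hB 0 (Classical.arbitrary _) (Classical.arbitrary _))
  obtain ⟨M, hM₀, hM⟩ : ∃ M : ℝ, 0 ≤ M ∧ ∀ i j, |J i j| ≤ M := by
    refine ⟨∑ i, ∑ j, |J i j|, by positivity, fun i j => ?_⟩
    refine (Finset.single_le_sum (f := fun j => |J i j|) (fun j _ => abs_nonneg _)
      (Finset.mem_univ j)).trans ?_
    exact Finset.single_le_sum (f := fun i => ∑ j, |J i j|)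
      (fun i _ => Finset.sum_nonneg fun j _ => abs_nonneg _) (Finset.mem_univ i)
  have hc : ∀ (c : ℕ → ℝ) (h : ℝ), (∀ r : ℕ, 1 ≤ r → c r * r = h) → ∀ r : ℕ, 1 ≤ r →
      c r = h / r := by
    intro c h hch r hr
    have : (r : ℝ) ≠ 0 := by positivity
    rw [← hch r hr, mul_div_cancel_right₀ _ this]
  have hne : ∀ (h : ℝ) (r : ℕ), 1 ≤ r → h ≤ 1 →
      (WeightedGraph.thresholdSet r (h / r)).Nonempty := by
    intro h r hr hh
    have : (0 : ℝ) < r := by exact_mod_cast hr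
    refine ⟨fun _ => 1 / r, ⟨fun _ => by positivity, ?_⟩,
      fun _ => div_le_div_of_nonneg_right hh this.le⟩
    simp [this.ne']
  refine exists_tendsto_of_approx fun ε hε => ?_
  set K := 2 * h₂ * q / (h₂ - h₁) with hK
  -- `B`, `M`, `q` and `K` do not depend on `m`, so the `O(1 / m)` error can be brought below `ε /
  -- 2`; the `α_max / α_G` error takes the other half once `m` is fixed.
  obtain ⟨m, hm⟩ := exists_nat_ge (max (max 1 K) (4 * (B * M) * (2 * (q * (1 + K))) / (ε / 2)))
  have hm1 : 1 ≤ m := by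
    have : (1 : ℝ) ≤ m := ((le_max_left _ _).trans (le_max_left _ _)).trans hm
    exact_mod_cast this
  have hmK : K ≤ m := ((le_max_right _ _).trans (le_max_left _ _)).trans hm
  have hm0 : (0 : ℝ) < m := by exact_mod_cast hm1
  have hmε : 4 * (B * M) * (2 * (q * ((1 + K) / m))) ≤ ε / 2 := by
    have := (le_max_right _ _).trans hm
    rw [div_le_iff₀ (by positivity)] at this
    have e : 4 * (B * M) * (2 * (q * ((1 + K) / m))) = 4 * (B * M) * (2 * (q * (1 + K))) / m := by
      ring
    rw [e, div_le_iff₀ hm0]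
    linarith
  -- `P` does not depend on `n`, so the minimum over it is a minimum of finitely many convergent
  -- sequences.
  let P : Finset (Fin m → Fin q) := Finset.univ.filter fun π =>
    ∀ i, h₁ / q ≤ fiberCard π i * (h₂ / m)
  have hP : P.Nonempty := by
    obtain ⟨a, ha⟩ := hne h₁ q hq (by linarith)
    obtain ⟨π, -, -, -, hπ, -⟩ :=
      exists_partition_near hq h₁_nonneg h₁_lt_h₂ h₂_le_one hm1 hmK ha
    exact ⟨π, by simpa [P] using hπ⟩
  choose l hl using fun π : Fin m → Fin q =>
    hconv m hm1 (J.submatrix π π) (hJ.submatrix π)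
  refine ⟨fun n => P.inf' hP fun π => (G n).lowerThresholdEnergy (c₂ m) (J.submatrix π π),
    P.inf' hP l, Tendsto.finset_inf'_nhds_apply hP fun π _ => hl π, ?_⟩
  have hsmall : Tendsto (fun n => 4 * (B * M) *
      (2 * ((m + q) * ((G n).maxWeight / (G n).totalWeight)))) atTop (𝓝 0) := by
    simpa using (((hα.const_mul ((m : ℝ) + q)).const_mul 2).const_mul (4 * (B * M)))
  filter_upwards [hsmall.eventually_le_const (by positivity : 0 < ε / 2)] with n hn
  have hδ : 0 ≤ (G n).maxWeight / (G n).totalWeight :=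
    div_nonneg (G n).maxWeight_nonneg (G n).totalWeight_pos.le
  rw [hc c₁ h₁ hc₁ q hq, hc c₂ h₂ hc₂ m hm1, abs_le]
  constructor
  · obtain ⟨a, ha, φ, hφ, hE⟩ := (G n).exists_energy_eq_lowerThresholdEnergy J
      (hne h₁ q hq (by linarith)) hq
    obtain ⟨π, b, hb, hk, hπ, hπb, hab⟩ :=
      exists_partition_near hq h₁_nonneg h₁_lt_h₂ h₂_le_one hm1 hmK ha
    have h1 := (G n).lowerThresholdEnergy_submatrix_le hB₀ hM₀ (hB n) hM π hk hb hπb hφ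
    have h2 := Finset.inf'_le (s := P)
      (fun π => (G n).lowerThresholdEnergy (h₂ / m) (J.submatrix π π)) (b := π)
      (by simpa [P] using hπ)
    have h3 : ∑ i, |a i - b i| ≤ q * ((1 + K) / m) := by
      simpa using Finset.sum_le_card_nsmul Finset.univ _ _ fun i _ => hab i
    have h4 : 4 * (B * M) * (2 * ∑ i, |a i - b i|) ≤ 4 * (B * M) * (2 * (q * ((1 + K) / m))) := by
      gcongr
    rw [hE] at h1
    linarith
  · obtain ⟨π, hπ, hmin⟩ := Finset.exists_mem_eq_inf' hP
      (fun π => (G n).lowerThresholdEnergy (h₂ / m) (J.submatrix π π))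
    have h1 := (G n).lowerThresholdEnergy_le_submatrix hB₀ hM₀ (hB n) hM π hm1
      (by simpa [P] using hπ) (hne h₂ m hm1 h₂_le_one)
    have h2 : 4 * (B * M) * (2 * m * ((G n).maxWeight / (G n).totalWeight)) ≤
        4 * (B * M) * (2 * ((m + q) * ((G n).maxWeight / (G n).totalWeight))) := by
      rw [mul_assoc 2]
      gcongr
      linarith [(Nat.cast_nonneg q : (0 : ℝ) ≤ q)]
    rw [hmin]
    linarith
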